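/- Let $p$ be a prime number, $k$ a field of characteristic $p$, and $G$ a locally profinite group (a locally compact, Hausdorff, totally disconnected topological group). Assume that $G$ has a compact open subgroup $H$ that is a (topologically) finitely generated pro-$p$-group. For a topological space $X$ and a $k$-vector space $V$, let $V[[X]]$ be the $k$-vector space of compactly supported finitely additive $V$-valued measures defined on all open-closed subsets of $X$. A smooth $G$-module over $k$ is a $k$-vector space with a $k$-linear action of $G$ such that the stabilizer of every vector is open in $G$. A $G$-contramodule over $k$ is a $k$-vector space $P$ with a $k$-linear map $\pi_P\colon P[[G]]\to P$ such that: (i) (contraassociativity) the two maps $P[[G\times G]]\rightrightarrows P[[G]]$, namely the pushforward of measures along the multiplication $G\times G\to G$ and the composition $P[[G\times G]]\to P[[G]][[G]]\to P[[G]]$ of the map $\mu\mapsto(B\mapsto(A\mapsto\mu(A\times B)))$ with the map induced by $\pi_P$, have equal compositions with $\pi_P$; (ii) (contraunitality) $\pi_P$ takes the point measure at $1\in G$ with value $y$ to $y$, for all $y\in P$. A $G$-contramodule $P$ has an underlying $G$-module structure in which $g\in G$ takes $y\in P$ to the image under $\pi_P$ of the point measure at $g^{-1}$ with value $y$. For a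 smooth $G$-module $N$ and a $G$-contramodule $P$ over $k$, the contratensor product $N\odot_{k,G}P$ is the cokernel of the difference of the two $k$-linear maps $N\otimes_kP[[G]]\rightrightarrows N\otimes_kP$ given by $x\otimes\mu\mapsto x\otimes\pi_P(\mu)$ and $x\otimes\mu\mapsto\int_G gx\otimes d\mu_g$, where the integral of the locally constant function $g\mapsto gx$ is $\sum_{v\in N}v\otimes\mu(\{g\in G: gx=v\})$, a sum with finitely many nonzero terms. For a subgroup $G'\subset G$, the tensor product $N\otimes_{k[G']}P$ is formed by viewing $N$ as a right $k[G']$-module via $xg=g^{-1}x$ and $P$ as a left $k[G']$-module via its underlying $G$-module structure. The identity map of $N\otimes_kP$ induces a natural $k$-linear map $N\otimes_{k[G']}P\to N\odot_{k,G}P$. Then for every smooth $G$-module $N$ and every $G$-contramodule $P$ over $k$, the natural map $$N\otimes_{k[G]}P\longrightarrow N\odot_{k,G}P$$ is an isomorphism. Moreover, for every dense subgroup $G'\subset G$, the natural map $$N\otimes_{k[G']}P\longrightarrow N\odot_{k,G}P$$ is an isomorphism. -/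

import Mathlib

open TopologicalSpace
open scoped TensorProduct

noncomputable section

namespace LocProfinite

/-! ### Pro-`p` groups and topological finite generation -/

/-- A topological group is a pro-`p` group if it is profinite (compact, Hausdorff, totally
disconnected) and all its finite quotients by open normal subgroups are `p`-groups. -/
structure IsProP (p : ℕ) (H : Type*) [Group H] [TopologicalSpace H] : Prop where
  topologicalGroup : IsTopologicalGroup H
  compact : CompactSpace H
  hausdorff : T2Space H
  totallyDisconnected : TotallyDisconnectedSpace H
  index_eq : ∀ U : Subgroup H, U.Normal → IsOpen (U : Set H) → ∃ n : ℕ, U.index = p ^ n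

/-- A topological group is (topologically) finitely generated if some finite set generates
a dense subgroup. -/
def IsTopologicallyFG (H : Type*) [Group H] [TopologicalSpace H] : Prop :=
  ∃ S : Finset H, Dense (Subgroup.closure (S : Set H) : Set H)

/-! ### Compactly supported finitely additive measures -/

section Measures

variable (k : Type*) [Field k]
variable (X : Type*) [TopologicalSpace X] (Y : Type*) [TopologicalSpace Y]
variable (V : Type*) [AddCommGroup V] [Module k V] (W : Type*) [AddCommGroup W] [Module k W]

/-- `V[[X]]`: the `k`-vector space of compactly supported finitely additive `V`-valued measures
defined on all the open-closed subsets of `X`. -/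
def csMeasure : Submodule k (Clopens X → V) where
  carrier := {μ | (∀ A B : Clopens X, Disjoint A B → μ (A ⊔ B) = μ A + μ B) ∧
    ∃ K : Set X, IsCompact K ∧ ∀ A : Clopens X, Disjoint (A : Set X) K → μ A = 0}
  zero_mem' := ⟨by simp, ∅, isCompact_empty, by simp⟩
  add_mem' := by
    rintro μ ν ⟨hμ, K, hK, hμK⟩ ⟨hν, L, hL, hνL⟩
    refine ⟨fun A B h => ?_, K ∪ L, hK.union hL, fun A h => ?_⟩
    · simp only [Pi.add_apply, hμ A B h, hν A B h]; abel
    · rw [Set.disjoint_union_right] at h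
      simp [hμK A h.1, hνL A h.2]
  smul_mem' := by
    rintro c μ ⟨hμ, K, hK, hμK⟩
    refine ⟨fun A B h => by simp [hμ A B h], K, hK, fun A h => by simp [hμK A h]⟩

variable {k X Y V W}

theorem csMeasure_add (μ : csMeasure k X V) (A B : Clopens X) (h : Disjoint A B) :
    μ.1 (A ⊔ B) = μ.1 A + μ.1 B := μ.2.1 A B h

theorem csMeasure_bot (μ : csMeasure k X V) : μ.1 ⊥ = 0 := by
  have h := csMeasure_add μ ⊥ ⊥ disjoint_bot_left
  simpa using h

/-- The preimage of an open-closed subset under a continuous map. -/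
def clopenPreimage (f : C(X, Y)) (A : Clopens Y) : Clopens X :=
  ⟨f ⁻¹' (A : Set Y), A.isClopen.preimage f.continuous⟩

/-- The pushforward map `V[[X]] → V[[Y]]` for a continuous map `X → Y`. -/
def pushforward (f : C(X, Y)) : csMeasure k X V →ₗ[k] csMeasure k Y V where
  toFun μ := ⟨fun A => μ.1 (clopenPreimage f A), by
    obtain ⟨μ, hμ, K, hK, hμK⟩ := μ
    refine ⟨fun A B h => ?_, f '' K, hK.image f.continuous, fun A h => ?_⟩
    · refine hμ (clopenPreimage f A) (clopenPreimage f B) ?_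
      rw [← Clopens.coe_disjoint] at h ⊢
      exact h.preimage f
    · refine hμK _ ?_
      rw [Set.disjoint_left] at h ⊢
      exact fun x hx hxK => h hx ⟨x, hxK, rfl⟩⟩
  map_add' _ _ := rfl
  map_smul' _ _ := rfl

/-- The map `V[[X]] → W[[X]]` induced by a linear map `V → W`. -/
def mapValues (φ : V →ₗ[k] W) : csMeasure k X V →ₗ[k] csMeasure k X W where
  toFun μ := ⟨fun A => φ (μ.1 A), by
    obtain ⟨μ, hμ, K, hK, hμK⟩ := μ
    exact ⟨fun A B h => by simp [hμ A B h], K, hK, fun A h => by simp [hμK A h]⟩⟩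
  map_add' _ _ := by ext; simp
  map_smul' _ _ := by ext; simp

/-- The natural map `V[[X × Y]] → V[[X]][[Y]]`, taking a measure `μ` to
`B ↦ (A ↦ μ (A × B))`. -/
def curryMeasure : csMeasure k (X × Y) V →ₗ[k] csMeasure k Y (csMeasure k X V) where
  toFun μ := ⟨fun B => ⟨fun A => μ.1 (A ×ˢ B), by
      obtain ⟨μ, hμ, K, hK, hμK⟩ := μ
      refine ⟨fun A A' h => ?_, Prod.fst '' K, hK.image continuous_fst, fun A h => ?_⟩
      · have e : (A ⊔ A') ×ˢ B = (A ×ˢ B) ⊔ (A' ×ˢ B) :=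
          Clopens.ext (Set.union_prod (s₁ := (A : Set X)) (s₂ := (A' : Set X)) (t := (B : Set Y)))
        have d : Disjoint (A ×ˢ B) (A' ×ˢ B) := by
          rw [← Clopens.coe_disjoint] at h ⊢
          exact Set.Disjoint.set_prod_left h _ _
        change μ ((A ⊔ A') ×ˢ B) = _
        rw [e]; exact hμ _ _ d
      · refine hμK _ (Set.disjoint_left.2 fun z hz hzK => ?_)
        exact Set.disjoint_left.1 h (show z.1 ∈ (A : Set X) from hz.1) ⟨z, hzK, rfl⟩⟩, by
    obtain ⟨μ, hμ, K, hK, hμK⟩ := μ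
    refine ⟨fun B B' h => ?_, Prod.snd '' K, hK.image continuous_snd, fun B h => ?_⟩
    · refine Subtype.ext (funext fun A => ?_)
      have e : A ×ˢ (B ⊔ B') = (A ×ˢ B) ⊔ (A ×ˢ B') :=
        Clopens.ext (Set.prod_union (s := (A : Set X)) (t₁ := (B : Set Y)) (t₂ := (B' : Set Y)))
      have d : Disjoint (A ×ˢ B) (A ×ˢ B') := by
        rw [← Clopens.coe_disjoint] at h ⊢
        exact Set.Disjoint.set_prod_right h _ _
      change μ (A ×ˢ (B ⊔ B')) = _
      rw [e]; exact hμ _ _ d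
    · refine Subtype.ext (funext fun A => hμK _ (Set.disjoint_left.2 fun z hz hzK => ?_))
      exact Set.disjoint_left.1 h (show z.2 ∈ (B : Set Y) from hz.2) ⟨z, hzK, rfl⟩⟩
  map_add' _ _ := rfl
  map_smul' _ _ := rfl

open Classical in
/-- The point measure concentrated at `a` and taking the value `v` on the neighborhoods of `a`. -/
def pointMeasure (a : X) : V →ₗ[k] csMeasure k X V where
  toFun v := ⟨fun A => if a ∈ A then v else 0, by
    refine ⟨fun A B h => ?_, {a}, isCompact_singleton, fun A h => ?_⟩
    · have h' : a ∈ A → a ∉ B := fun hA =>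
        Set.disjoint_left.1 (Clopens.coe_disjoint.2 h) hA
      have e : a ∈ A ⊔ B ↔ a ∈ A ∨ a ∈ B := Iff.rfl
      by_cases hA : a ∈ A
      · have hB : a ∉ B := h' hA
        simp [e, hA, hB]
      · simp [e, hA]
    · have : a ∉ A := by simpa using h
      simp [this]⟩
  map_add' v w := by ext A; by_cases h : a ∈ A <;> simp [h]
  map_smul' c v := by ext A; by_cases h : a ∈ A <;> simp [h]

open Classical in
theorem pointMeasure_apply (a : X) (v : V) (A : Clopens X) :
    (pointMeasure (k := k) a v).1 A = if a ∈ A then v else 0 := rfl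

/-! ### Integration of locally constant functions -/

/-- The fibre of a locally constant function, as an open-closed subset. -/
def fiber {A : Type*} (f : LocallyConstant X A) (a : A) : Clopens X :=
  ⟨f ⁻¹' {a}, f.isLocallyConstant.isClopen_fiber a⟩

variable (k) in
/-- The integral `∫ f ⊗ dμ ∈ N ⊗ V` of a locally constant function `f : X → N` with respect to
a compactly supported measure `μ ∈ V[[X]]`: the sum over all `x ∈ N` of `x ⊗ μ(f⁻¹(x))`, where
only finitely many terms are nonzero (see `integral_eq_sum`). -/
def integral {N : Type*} [AddCommGroup N] [Module k N] (f : LocallyConstant X N)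
    (μ : csMeasure k X V) : N ⊗[k] V :=
  ∑ᶠ x : N, x ⊗ₜ[k] μ.1 (fiber f x)

/-- A measure is determined by its restrictions to finitely many fibres of a locally constant
function that cover a compact support. -/
theorem csMeasure_eq_sum_fibers {A : Type*} (f : LocallyConstant X A) (μ : csMeasure k X V)
    {K : Set X} (hμK : ∀ B : Clopens X, Disjoint (B : Set X) K → μ.1 B = 0)
    (s : Finset A) (U : Clopens X) (hs : ∀ x ∈ K, x ∈ U → f x ∈ s) :
    μ.1 U = ∑ a ∈ s, μ.1 (U ⊓ fiber f a) := by
  classical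
  induction s using Finset.induction_on generalizing U with
  | empty =>
    simp only [Finset.sum_empty]
    exact hμK U (Set.disjoint_left.2 fun x hx hxK => by simpa using hs x hxK hx)
  | insert a s ha ih =>
    rw [Finset.sum_insert ha]
    have h1 : μ.1 U = μ.1 (U ⊓ fiber f a) + μ.1 (U \ fiber f a) := by
      rw [← csMeasure_add μ _ _ (disjoint_inf_sdiff), sup_inf_sdiff]
    rw [h1, ih (U \ fiber f a)]
    · congr 1
      refine Finset.sum_congr rfl fun b hb => ?_
      refine congrArg μ.1 (Clopens.ext (Set.ext fun x => ?_))
      constructor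
      · rintro ⟨⟨h1, _⟩, h3⟩
        exact ⟨h1, h3⟩
      · rintro ⟨h1, h3⟩
        refine ⟨⟨h1, fun h => ha ?_⟩, h3⟩
        have e1 : f x = a := h
        have e2 : f x = b := h3
        rw [← e1, e2]; exact hb
    · rintro x hxK ⟨hx, hx'⟩
      exact (Finset.mem_insert.1 (hs x hxK hx)).resolve_left hx'

theorem exists_fiber_finset {A : Type*} (f : LocallyConstant X A) {K : Set X} (hK : IsCompact K) :
    ∃ s : Finset A, ∀ x ∈ K, f x ∈ s := by
  have hfin : (f '' K).Finite := by
    let _ : TopologicalSpace A := ⊥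
    have : DiscreteTopology A := ⟨rfl⟩
    exact (hK.image f.isLocallyConstant.continuous).finite_of_discrete
  exact ⟨hfin.toFinset, fun x hx => by simpa using ⟨x, hx, rfl⟩⟩

/-- Computation of the integral on a partition by the fibres of a finer function. -/
theorem integral_map_eq_sum {N : Type*} [AddCommGroup N] [Module k N] {A : Type*}
    (f : LocallyConstant X A) (φ : A → N) (μ : csMeasure k X V)
    {K : Set X} (hμK : ∀ B : Clopens X, Disjoint (B : Set X) K → μ.1 B = 0)
    (s : Finset A) (hs : ∀ x ∈ K, f x ∈ s) :
    integral k (f.map φ) μ = ∑ a ∈ s, φ a ⊗ₜ[k] μ.1 (fiber f a) := by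
  classical
  have key : ∀ v : N, μ.1 (fiber (f.map φ) v) = ∑ a ∈ s with φ a = v, μ.1 (fiber f a) := by
    intro v
    rw [csMeasure_eq_sum_fibers f μ hμK (s.filter fun a => φ a = v)]
    · refine Finset.sum_congr rfl fun a ha => ?_
      refine congrArg μ.1 (Clopens.ext (Set.ext fun x => ?_))
      refine Iff.intro (fun h => And.right h) fun h => And.intro ?_ h
      have h' : f x = a := h
      change φ (f x) = v
      rw [h']; exact (Finset.mem_filter.1 ha).2
    · intro x hxK hx
      exact Finset.mem_filter.2 ⟨hs x hxK, hx⟩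
  have hsupp : (Function.support fun v : N => v ⊗ₜ[k] μ.1 (fiber (f.map φ) v)) ⊆
      (s.image φ : Finset N) := by
    intro v hv
    by_contra hv'
    refine hv ?_
    have : s.filter (fun a => φ a = v) = ∅ := by
      refine Finset.filter_eq_empty_iff.2 fun a ha h => hv' ?_
      exact Finset.mem_coe.2 (Finset.mem_image.2 ⟨a, ha, h⟩)
    change v ⊗ₜ[k] μ.1 (fiber (f.map φ) v) = 0
    rw [key, this]; simp
  rw [integral, finsum_eq_sum_of_support_subset _ hsupp,
    ← Finset.sum_fiberwise_of_maps_to (s := s) (t := s.image φ) (g := φ)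
      (fun a ha => Finset.mem_image_of_mem φ ha)]
  refine Finset.sum_congr rfl fun v _ => ?_
  rw [key, TensorProduct.tmul_sum]
  refine Finset.sum_congr rfl fun a ha => ?_
  rw [(Finset.mem_filter.1 ha).2]

theorem integral_eq_sum {N : Type*} [AddCommGroup N] [Module k N]
    (f : LocallyConstant X N) (μ : csMeasure k X V)
    {K : Set X} (hμK : ∀ B : Clopens X, Disjoint (B : Set X) K → μ.1 B = 0)
    (s : Finset N) (hs : ∀ x ∈ K, f x ∈ s) :
    integral k f μ = ∑ x ∈ s, x ⊗ₜ[k] μ.1 (fiber f x) :=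
  integral_map_eq_sum f id μ hμK s hs

theorem integral_add_left {N : Type*} [AddCommGroup N] [Module k N]
    (f g : LocallyConstant X N) (μ : csMeasure k X V) :
    integral k (f + g) μ = integral k f μ + integral k g μ := by
  obtain ⟨K, hK, hμK⟩ := μ.2.2
  let h : LocallyConstant X (N × N) :=
    ⟨fun x => (f x, g x), f.isLocallyConstant.prodMk g.isLocallyConstant⟩
  obtain ⟨s, hs⟩ := exists_fiber_finset h hK
  have e1 := integral_map_eq_sum h (fun a => a.1 + a.2) μ hμK s hs
  have e2 := integral_map_eq_sum h (fun a => a.1) μ hμK s hs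
  have e3 := integral_map_eq_sum h (fun a => a.2) μ hμK s hs
  change integral k (f + g) μ = _ at e1
  change integral k f μ = _ at e2
  change integral k g μ = _ at e3
  rw [e1, e2, e3, ← Finset.sum_add_distrib]
  exact Finset.sum_congr rfl fun a _ => TensorProduct.add_tmul _ _ _

theorem integral_smul_left {N : Type*} [AddCommGroup N] [Module k N]
    (c : k) (f : LocallyConstant X N) (μ : csMeasure k X V) :
    integral k (c • f) μ = c • integral k f μ := by
  obtain ⟨K, hK, hμK⟩ := μ.2.2
  obtain ⟨s, hs⟩ := exists_fiber_finset f hK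
  have e1 := integral_map_eq_sum f (fun a => c • a) μ hμK s hs
  change integral k (c • f) μ = _ at e1
  rw [e1, integral_eq_sum f μ hμK s hs, Finset.smul_sum]
  exact Finset.sum_congr rfl fun a _ => (TensorProduct.smul_tmul' _ _ _).symm

theorem integral_add_right {N : Type*} [AddCommGroup N] [Module k N]
    (f : LocallyConstant X N) (μ ν : csMeasure k X V) :
    integral k f (μ + ν) = integral k f μ + integral k f ν := by
  obtain ⟨K, hK, hμK⟩ := μ.2.2
  obtain ⟨L, hL, hνL⟩ := ν.2.2
  obtain ⟨s, hs⟩ := exists_fiber_finset f (hK.union hL)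
  have hμ : ∀ B : Clopens X, Disjoint (B : Set X) (K ∪ L) → μ.1 B = 0 :=
    fun B h => hμK B (Set.disjoint_union_right.1 h).1
  have hν : ∀ B : Clopens X, Disjoint (B : Set X) (K ∪ L) → ν.1 B = 0 :=
    fun B h => hνL B (Set.disjoint_union_right.1 h).2
  have hμν : ∀ B : Clopens X, Disjoint (B : Set X) (K ∪ L) → (μ + ν).1 B = 0 := by
    intro B h
    change μ.1 B + ν.1 B = 0
    rw [hμ B h, hν B h, add_zero]
  rw [integral_eq_sum f _ hμν s hs, integral_eq_sum f _ hμ s hs, integral_eq_sum f _ hν s hs,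
    ← Finset.sum_add_distrib]
  exact Finset.sum_congr rfl fun a _ => TensorProduct.tmul_add _ _ _

theorem integral_smul_right {N : Type*} [AddCommGroup N] [Module k N]
    (f : LocallyConstant X N) (c : k) (μ : csMeasure k X V) :
    integral k f (c • μ) = c • integral k f μ := by
  obtain ⟨K, hK, hμK⟩ := μ.2.2
  obtain ⟨s, hs⟩ := exists_fiber_finset f hK
  have hc : ∀ B : Clopens X, Disjoint (B : Set X) K → (c • μ).1 B = 0 := by
    intro B h
    change c • μ.1 B = 0
    rw [hμK B h, smul_zero]
  rw [integral_eq_sum f _ hc s hs, integral_eq_sum f _ hμK s hs, Finset.smul_sum]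
  exact Finset.sum_congr rfl fun a _ => TensorProduct.tmul_smul _ _ _

theorem integral_pointMeasure {N : Type*} [AddCommGroup N] [Module k N]
    (f : LocallyConstant X N) (a : X) (v : V) :
    integral k f (pointMeasure (k := k) a v) = f a ⊗ₜ[k] v := by
  classical
  rw [integral_eq_sum f _ (K := {a}) _ {f a} (by simp)]
  · rw [Finset.sum_singleton, pointMeasure_apply, if_pos (show a ∈ fiber f (f a) from rfl)]
  · intro B hB
    rw [pointMeasure_apply, if_neg]
    simpa using hB

end Measures

/-! ### Smooth modules and contramodules -/

section Modules

variable {k : Type*} [Field k] {G : Type*} [Group G] [TopologicalSpace G]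
variable {N : Type*} [AddCommGroup N] [Module k N]
variable {P : Type*} [AddCommGroup P] [Module k P]

/-- A `G`-module over `k` is smooth if the stabilizer of every element is open. -/
def IsSmooth (ρ : Representation k G N) : Prop :=
  ∀ x : N, IsOpen {g : G | ρ g x = x}

variable (k G P) in
/-- A `G`-contramodule structure on the `k`-vector space `P`: a linear contraaction map
`π : P[[G]] → P` which is contraassociative, that is, the two maps `P[[G × G]] ⇉ P[[G]]`,
given by the pushforward along the multiplication of `G`, and by the composition
`P[[G × G]] → P[[G]][[G]] → P[[G]]` with the second map induced by `π`,
have equal compositions with `π`; and contraunital, that is, `π` takes the point measure at `1`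
with the value `x` to `x`. -/
structure Contramodule [ContinuousMul G] where
  /-- the contraaction map `P[[G]] → P` -/
  contraaction : csMeasure k G P →ₗ[k] P
  contraassociative : ∀ μ : csMeasure k (G × G) P,
    contraaction (pushforward ⟨fun z => z.1 * z.2, continuous_mul⟩ μ) =
      contraaction (mapValues contraaction (curryMeasure μ))
  contraunital : ∀ x : P, contraaction (pointMeasure 1 x) = x

theorem Contramodule.contraaction_mul [ContinuousMul G] (π : Contramodule k G P) (g h : G)
    (x : P) : π.contraaction (pointMeasure (g * h) x) =
      π.contraaction (pointMeasure h (π.contraaction (pointMeasure g x))) := by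
  classical
  have e := π.contraassociative (pointMeasure (g, h) x)
  have e1 : pushforward ⟨fun z : G × G => z.1 * z.2, continuous_mul⟩
      (pointMeasure (k := k) (g, h) x) = pointMeasure (g * h) x := rfl
  have e2 : mapValues π.contraaction (curryMeasure (pointMeasure (k := k) (g, h) x)) =
      pointMeasure h (π.contraaction (pointMeasure g x)) := by
    refine Subtype.ext (funext fun B => ?_)
    rw [pointMeasure_apply]
    have e3 : (curryMeasure (pointMeasure (k := k) (g, h) x)).1 B =
        if h ∈ B then pointMeasure g x else 0 := by
      refine Subtype.ext (funext fun A => ?_)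
      change (if (g, h) ∈ A ×ˢ B then x else 0) = _
      by_cases hB : h ∈ B <;> by_cases hA : g ∈ A <;>
        simp [hA, hB, pointMeasure_apply, Clopens.mem_prod]
    change π.contraaction ((curryMeasure (pointMeasure (k := k) (g, h) x)).1 B) = _
    rw [e3]
    split_ifs <;> simp
  rw [e1, e2] at e
  exact e

/-- The underlying `G`-module of a `G`-contramodule: `g ∈ G` acts on `x ∈ P` by the contraaction
applied to the point measure at `g⁻¹` with the value `x`. (Equivalently, the point measures at `g`
define a right action of `G` on `P`.) -/
def Contramodule.rep [ContinuousMul G] (π : Contramodule k G P) : Representation k G P where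
  toFun g := π.contraaction ∘ₗ pointMeasure g⁻¹
  map_one' := by
    ext x
    simpa using π.contraunital x
  map_mul' g h := by
    ext x
    simp only [LinearMap.comp_apply, Module.End.mul_apply, mul_inv_rev, π.contraaction_mul]

/-- For a smooth `G`-module `N` and `x ∈ N`, the locally constant function `g ↦ g x`. -/
def orbitMap [ContinuousMul G] (ρ : Representation k G N) (hρ : IsSmooth ρ) (x : N) :
    LocallyConstant G N where
  toFun g := ρ g x
  isLocallyConstant := by
    rw [IsLocallyConstant.iff_exists_open]
    intro g
    refine ⟨(fun h => g⁻¹ * h) ⁻¹' {h | ρ h x = x}, (hρ x).preimage (continuous_const_mul _),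
      by simp, fun h hh => ?_⟩
    have hh' : ρ (g⁻¹ * h) x = x := hh
    have : ρ g (ρ (g⁻¹ * h) x) = ρ h x := by
      rw [← Module.End.mul_apply, ← map_mul, mul_inv_cancel_left]
    rw [← this, hh']

/-- The map `N ⊗ P[[G]] → N ⊗ P`, `x ⊗ μ ↦ x ⊗ π(μ)`. -/
def contraMap [ContinuousMul G] (N : Type*) [AddCommGroup N] [Module k N]
    (π : Contramodule k G P) : N ⊗[k] csMeasure k G P →ₗ[k] N ⊗[k] P :=
  LinearMap.lTensor N π.contraaction

/-- The map `N ⊗ P[[G]] → N ⊗ P`, `x ⊗ μ ↦ ∫_G x g⁻¹ ⊗ dμ_g`, where `x g⁻¹ = g x`. -/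
def integralMap [ContinuousMul G] (ρ : Representation k G N) (hρ : IsSmooth ρ)
    (P : Type*) [AddCommGroup P] [Module k P] : N ⊗[k] csMeasure k G P →ₗ[k] N ⊗[k] P :=
  TensorProduct.lift <| LinearMap.mk₂ k (fun x μ => integral k (orbitMap ρ hρ x) μ)
    (fun x y μ => by
      rw [← integral_add_left]; congr 1; ext g; exact map_add (ρ g) x y)
    (fun c x μ => by
      rw [← integral_smul_left]; congr 1; ext g; exact map_smul (ρ g) c x)
    (fun _ _ _ => integral_add_right _ _ _)
    (fun _ _ _ => integral_smul_right _ _ _)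

/-- The contratensor product of a smooth `G`-module and a `G`-contramodule: the cokernel of the
difference of the two maps `N ⊗ P[[G]] ⇉ N ⊗ P`. -/
abbrev Contratensor [ContinuousMul G] (ρ : Representation k G N) (hρ : IsSmooth ρ)
    (π : Contramodule k G P) : Type _ :=
  (N ⊗[k] P) ⧸ LinearMap.range (contraMap N π - integralMap ρ hρ P)

/-! ### The tensor product over the group algebra -/

/-- The right `k[Γ]`-module structure on a `Γ`-module, `x g = g⁻¹ x`, as an algebra homomorphism
to the opposite of the endomorphism algebra. -/
def rightAction {Γ : Type*} [Group Γ] (ρ : Representation k Γ N) :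
    MonoidAlgebra k Γ →ₐ[k] (Module.End k N)ᵐᵒᵖ :=
  MonoidAlgebra.lift k _ Γ
    { toFun := fun g => MulOpposite.op (ρ g⁻¹)
      map_one' := by simp
      map_mul' := fun g h => by simp }

/-- The submodule of `N ⊗ P` spanned by the elements `x r ⊗ y - x ⊗ r y` with `r ∈ k[Γ]`. -/
def balancedRelations {Γ : Type*} [Group Γ] (ρ : Representation k Γ N)
    (σ : Representation k Γ P) : Submodule k (N ⊗[k] P) :=
  Submodule.span k {t | ∃ (x : N) (r : MonoidAlgebra k Γ) (y : P),
    t = (rightAction ρ r).unop x ⊗ₜ[k] y - x ⊗ₜ[k] σ.asAlgebraHom r y}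

/-- The tensor product `N ⊗_{k[Γ]} P` of two `Γ`-modules over `k`, the first one being viewed as
a right `k[Γ]`-module via `x g = g⁻¹ x`. -/
abbrev GroupTensor {Γ : Type*} [Group Γ] (ρ : Representation k Γ N)
    (σ : Representation k Γ P) : Type _ :=
  (N ⊗[k] P) ⧸ balancedRelations ρ σ

theorem balancedRelations_le [ContinuousMul G] {Γ : Type*} [Group Γ] (i : Γ →* G)
    (ρ : Representation k G N) (hρ : IsSmooth ρ) (π : Contramodule k G P) :
    balancedRelations (ρ.comp i) (π.rep.comp i) ≤
      LinearMap.range (contraMap N π - integralMap ρ hρ P) := by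
  rw [balancedRelations, Submodule.span_le]
  rintro _ ⟨x, r, y, rfl⟩
  simp only [SetLike.mem_coe]
  induction r using MonoidAlgebra.induction_linear with
  | zero => simp
  | add r s hr hs =>
    have := Submodule.add_mem _ hr hs
    simp only [map_add, MulOpposite.unop_add, LinearMap.add_apply, TensorProduct.add_tmul,
      TensorProduct.tmul_add]
    convert this using 1
    abel
  | single g c =>
    refine ⟨-(c • (x ⊗ₜ[k] pointMeasure (i g)⁻¹ y)), ?_⟩
    simp [contraMap, integralMap, rightAction, integral_pointMeasure, orbitMap,
      Contramodule.rep, MonoidAlgebra.lift_single, TensorProduct.smul_tmul']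
    abel

/-- The natural map from `N ⊗_{k[G]} P` to the contratensor product, induced by the identity map
of `N ⊗ P`. -/
def toContratensor [ContinuousMul G] (ρ : Representation k G N) (hρ : IsSmooth ρ)
    (π : Contramodule k G P) : GroupTensor ρ π.rep →ₗ[k] Contratensor ρ hρ π :=
  Submodule.factor (balancedRelations_le (MonoidHom.id G) ρ hρ π)

/-- The natural map from `N ⊗_{k[G']} P` to the contratensor product for a subgroup `G'` of `G`,
induced by the identity map of `N ⊗ P`. -/
def subgroupToContratensor [ContinuousMul G] (G' : Subgroup G) (ρ : Representation k G N)
    (hρ : IsSmooth ρ) (π : Contramodule k G P) :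
    GroupTensor (ρ.comp G'.subtype) (π.rep.comp G'.subtype) →ₗ[k] Contratensor ρ hρ π :=
  Submodule.factor (balancedRelations_le G'.subtype ρ hρ π)

end Modules

end LocProfinite

end

open TopologicalSpace
open scoped TensorProduct

noncomputable section

namespace LocProfinite

/-! ### Generators of pro-`p` groups in dense subgroups -/

section ProP

variable {p : ℕ} [Fact p.Prime] {H : Type*} [Group H] [TopologicalSpace H]

/-! Both sides are quotients of `N ⊗ P`, and the comparison maps come from an inclusion of relations
(`balancedRelations_le`). It remains to derive each contratensor relation `x ⊗ π(μ) - ∫ gx ⊗ dμ`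
from relations of a dense group `Γ` (`range_le_balancedRelations`).

Let `U` be the stabilizer of `x` in `H`. Cut `μ` along the cosets of `U`, each represented by an
element of `Γ`; translation reduces the claim to a measure `ν` concentrated on `U`, where it says
that `x ⊗ (π(ν) - ν(U))` is a relation. If `U` is topologically generated by a finite set `T` in
`Γ`, duality with locally constant functions gives `ν = δ₁ ν(U) + ∑ (μ_t t - μ_t)` over `t ∈ T`
(`exists_eq_sum_translates`). Applying `π` turns each summand into `t⁻¹y - y`, and `x ⊗ (t⁻¹y - y)`
is a relation because `t` fixes `x`.

The set `T` comes from group theory. A proper closed subgroup of a pro-`p` group lies in the kernel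
of a nontrivial continuous character to `ℤ/p`. When the group is topologically finitely generated
there are finitely many such characters, so generators can be moved into a dense subgroup modulo
their open common kernel (`IsProP.exists_finset_generators`). Schreier's lemma then passes from `H`
to the open subgroup `U`. -/

theorem _root_.Subgroup.exists_hom_zmod_of_ne_top {Q : Type*} [Group Q] [Finite Q] {n : ℕ}
    (hQ : Nat.card Q = p ^ n) (L : Subgroup Q) (hL : L ≠ ⊤) :
    ∃ χ : Q →* Multiplicative (ZMod p), L ≤ χ.ker ∧ χ ≠ 1 := by
  have hp : p.Prime := Fact.out
  obtain ⟨j, hj, hLj⟩ := (Nat.dvd_prime_pow hp).1 (hQ ▸ L.card_subgroup_dvd_card)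
  have hjn : j < n := by
    refine lt_of_le_of_ne hj fun h => hL (Subgroup.eq_top_of_card_eq L ?_)
    rw [hLj, hQ, h]
  -- Sylow theory enlarges `L` to a subgroup `K` of order `p ^ m`. Its index `p` is the least prime
  -- factor of the group order, so `K` is normal with quotient of order `p`.
  obtain ⟨m, rfl⟩ : ∃ m, n = m + 1 := ⟨n - 1, by omega⟩
  obtain ⟨K, hK, hLK⟩ := Sylow.exists_subgroup_card_pow_prime_le p
    (hQ ▸ pow_dvd_pow p m.le_succ) L hLj (Nat.lt_succ_iff.1 hjn)
  have hidx : K.index = p := by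
    have h := K.card_mul_index
    rw [hK, hQ, pow_succ] at h
    exact Nat.eq_of_mul_eq_mul_left (pow_pos hp.pos m) h
  have hnormal : K.Normal := by
    refine Subgroup.normal_of_index_eq_minFac_card ?_
    rw [hidx, hQ, Nat.Prime.pow_minFac hp m.succ_ne_zero]
  have hcard : Nat.card (Multiplicative (ZMod p)) = p := Nat.card_zmod p
  let e : Q ⧸ K ≃* Multiplicative (ZMod p) := mulEquivOfPrimeCardEq hidx hcard
  have hker : (e.toMonoidHom.comp (QuotientGroup.mk' K)).ker = K := by
    ext x
    simp
  refine ⟨e.toMonoidHom.comp (QuotientGroup.mk' K), hker.symm ▸ hLK, fun h => ?_⟩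
  rw [h, MonoidHom.ker_one] at hker
  rw [← hker, Subgroup.index_top] at hidx
  exact hp.one_lt.ne hidx

/-- An open normal `V` with `gV` disjoint from the closure of `L` makes the image of `L` in the
finite `p`-group `H ⧸ V` proper, and a character of that quotient pulls back to `H`. -/
theorem IsProP.exists_hom_of_not_dense (hH : IsProP p H) (L : Subgroup H)
    (hL : ¬ Dense (L : Set H)) :
    ∃ χ : H →* Multiplicative (ZMod p), IsOpen (χ.ker : Set H) ∧ L ≤ χ.ker ∧ χ ≠ 1 := by
  have := hH.topologicalGroup
  have := hH.compact
  have := hH.hausdorff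
  have := hH.totallyDisconnected
  obtain ⟨g, hg⟩ : ∃ g, g ∉ closure (L : Set H) := by
    by_contra! h
    exact hL h
  obtain ⟨V, hV⟩ := ProfiniteGrp.exist_openNormalSubgroup_sub_open_nhds_of_one
    (G := H) (U := (fun v => g * v) ⁻¹' (closure (L : Set H))ᶜ)
    (isClosed_closure.isOpen_compl.preimage (continuous_const_mul g)) (by simpa using hg)
  have hVopen : IsOpen (V.toSubgroup : Set H) := V.isOpen'
  obtain ⟨n, hn⟩ := hH.index_eq V.toSubgroup inferInstance hVopen
  have hfin : Finite (H ⧸ V.toSubgroup) := V.toSubgroup.quotient_finite_of_isOpen hVopen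
  obtain ⟨χ, hχL, hχ⟩ := Subgroup.exists_hom_zmod_of_ne_top (p := p) (n := n) hn
    (L.map (QuotientGroup.mk' V.toSubgroup)) (by
      intro h
      have hmem : (g : H ⧸ V.toSubgroup) ∈ L.map (QuotientGroup.mk' V.toSubgroup) :=
        h ▸ Subgroup.mem_top _
      obtain ⟨l, hl, hlg⟩ := hmem
      have h1 : g⁻¹ * l ∈ V.toSubgroup := QuotientGroup.eq.1 hlg.symm
      have h2 : g * (g⁻¹ * l) ∉ closure (L : Set H) := hV h1
      rw [mul_inv_cancel_left] at h2
      exact h2 (subset_closure hl))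
  refine ⟨χ.comp (QuotientGroup.mk' V.toSubgroup), ?_, ?_, ?_⟩
  · refine Subgroup.isOpen_mono (H₁ := V.toSubgroup) (fun v hv => ?_) hVopen
    rw [MonoidHom.mem_ker, MonoidHom.comp_apply, QuotientGroup.mk'_apply,
      (QuotientGroup.eq_one_iff v).2 hv, map_one]
  · exact fun l hl => hχL (Subgroup.mem_map_of_mem _ hl)
  · intro h
    refine hχ (MonoidHom.ext fun q => ?_)
    obtain ⟨x, rfl⟩ := QuotientGroup.mk_surjective q
    exact DFunLike.congr_fun h x

/-- The equalizer contains the intersection of two open kernels, so it is an open, hence closed,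
subgroup; it is also dense. -/
theorem hom_eq_of_eqOn_of_dense [ContinuousMul H] {A : Type*} [Group A] {S : Set H}
    (hS : Dense (Subgroup.closure S : Set H)) {χ ψ : H →* A} (hχ : IsOpen (χ.ker : Set H))
    (hψ : IsOpen (ψ.ker : Set H)) (h : Set.EqOn χ ψ S) : χ = ψ := by
  have hopen : IsOpen (χ.eqLocus ψ : Set H) := by
    refine Subgroup.isOpen_mono (H₁ := χ.ker ⊓ ψ.ker) (fun x hx => ?_) (hχ.inter hψ)
    exact (MonoidHom.mem_ker.1 hx.1).trans (MonoidHom.mem_ker.1 hx.2).symm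
  have hclosed := Subgroup.isClosed_of_isOpen _ hopen
  have hle : Subgroup.closure S ≤ χ.eqLocus ψ := (Subgroup.closure_le _).2 h
  have hd : Dense (χ.eqLocus ψ : Set H) := hS.mono hle
  ext x
  have hx : x ∈ (χ.eqLocus ψ : Set H) := hclosed.closure_eq ▸ hd x
  exact hx

/-- A dense subgroup of a topologically finitely generated pro-`p` group contains a finite set
of topological generators. -/
theorem IsProP.exists_finset_generators (hH : IsProP p H) (hfg : IsTopologicallyFG H)
    (D : Subgroup H) (hD : Dense (D : Set H)) :
    ∃ S : Finset H, (S : Set H) ⊆ D ∧ Dense (Subgroup.closure (S : Set H) : Set H) := by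
  classical
  have := hH.topologicalGroup
  obtain ⟨S, hS⟩ := hfg
  let X : Set (H →* Multiplicative (ZMod p)) := {χ | IsOpen (χ.ker : Set H)}
  have hX : X.Finite := by
    have : NeZero p := ⟨(Fact.out : p.Prime).ne_zero⟩
    have : Finite (Multiplicative (ZMod p)) := inferInstanceAs (Finite (ZMod p))
    -- A continuous character is determined by its values on `S`, which leaves finitely many
    -- possibilities.
    refine Set.Finite.of_injOn (f := fun χ (s : S) => χ s) (t := Set.univ)
      (Set.mapsTo_univ _ _) (fun χ hχ ψ hψ h => ?_) Set.finite_univ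
    exact hom_eq_of_eqOn_of_dense hS hχ hψ fun s hs => congrFun h ⟨s, hs⟩
  have hV : IsOpen (⋂ χ ∈ X, (χ.ker : Set H)) := hX.isOpen_biInter fun χ hχ => hχ
  -- The common kernel of all continuous characters to `ℤ/p`, the analogue of the Frattini subgroup,
  -- is open, so each of its cosets meets `D`.
  have hex : ∀ s : H, ∃ d ∈ (D : Set H), s⁻¹ * d ∈ ⋂ χ ∈ X, (χ.ker : Set H) := by
    intro s
    obtain ⟨d, hd, hd'⟩ := hD.exists_mem_open (hV.preimage (continuous_const_mul s⁻¹))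
      ⟨s, by simp⟩
    exact ⟨d, hd, hd'⟩
  choose d hdD hd using hex
  refine ⟨S.image d, fun x hx => ?_, ?_⟩
  · obtain ⟨s, -, rfl⟩ := Finset.mem_image.1 (Finset.mem_coe.1 hx)
    exact hdD s
  -- A character killing every `d s` also kills every `s`, since `s⁻¹ * d s` lies in its kernel;
  -- hence it is trivial.
  · by_contra hnd
    obtain ⟨χ, hχ, hle, hne⟩ := hH.exists_hom_of_not_dense _ hnd
    refine hne (hom_eq_of_eqOn_of_dense hS hχ (by simp) fun s hs => ?_)
    have h1 : χ (d s) = 1 := hle (Subgroup.subset_closure (by simpa using ⟨s, hs, rfl⟩))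
    have h2 : χ (s⁻¹ * d s) = 1 := Set.mem_iInter₂.1 (hd s) χ hχ
    rwa [map_mul, h1, mul_one, map_inv, inv_eq_one] at h2

/-- If a finite set topologically generates a compact open subgroup `H`, then every open subgroup
of `H` is topologically generated by finitely many elements of the abstract group it generates. -/
theorem exists_finset_generators_of_open {G : Type*} [Group G] [TopologicalSpace G]
    [IsTopologicalGroup G] {H : Subgroup G} (hHc : IsCompact (H : Set G))
    (S : Finset G) (hSH : (S : Set G) ⊆ H)
    (hS : (H : Set G) ⊆ closure (Subgroup.closure (S : Set G) : Set G))
    (U : Subgroup G) (hU : IsOpen (U : Set G)) (hUH : U ≤ H) :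
    ∃ T : Finset G, (T : Set G) ⊆ Subgroup.closure (S : Set G) ∧
      (T : Set G) ⊆ U ∧ (U : Set G) ⊆ closure (Subgroup.closure (T : Set G) : Set G) := by
  classical
  let Γ := Subgroup.closure (S : Set G)
  have hΓH : Γ ≤ H := (Subgroup.closure_le _).2 hSH
  have hfg : Group.FG Γ := Group.closure_finset_fg S
  have hfi : (U.subgroupOf H).FiniteIndex := by
    have : CompactSpace H := isCompact_iff_compactSpace.1 hHc
    have := (U.subgroupOf H).quotient_finite_of_isOpen (hU.preimage continuous_subtype_val)
    exact Subgroup.finiteIndex_of_finite_quotient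
  have hfi' : (U.subgroupOf Γ).FiniteIndex := by
    refine ⟨fun h => hfi.index_ne_zero ?_⟩
    exact Subgroup.relIndex_eq_zero_of_le_right hΓH h
  -- Schreier's lemma, applied to the abstract finitely generated group `Γ`.
  have : Group.FG (U.subgroupOf Γ) := Subgroup.fg_of_index_ne_zero _
  have hfg' : (U ⊓ Γ).FG := by
    have h := (Group.fg_iff_subgroup_fg (U.subgroupOf Γ)).1 this
    rw [Subgroup.fg_iff_submonoid_fg] at h ⊢
    rw [← Subgroup.subgroupOf_map_subtype]
    exact h.map Γ.subtype
  obtain ⟨T, hT⟩ := hfg'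
  have hTle : (T : Set G) ⊆ (U ⊓ Γ : Subgroup G) := hT ▸ Subgroup.subset_closure
  refine ⟨T, fun t ht => (hTle ht).2, fun t ht => (hTle ht).1, ?_⟩
  rw [hT]
  intro u hu
  rw [mem_closure_iff]
  intro O hO huO
  -- As `U` is open, density of `Γ` in `H` gives density of `U ⊓ Γ` in `U`.
  obtain ⟨γ, hγ, hγΓ⟩ := mem_closure_iff.1 (hS (hUH hu)) (O ∩ U) (hO.inter hU) ⟨huO, hu⟩
  exact ⟨γ, hγ.1, hγ.2, hγΓ⟩

end ProP

/-! ### Measures and linear functionals on locally constant functions -/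

section Functionals

variable {k : Type*} [Field k] {X : Type*} [TopologicalSpace X]
variable {V : Type*} [AddCommGroup V] [Module k V]

variable (k) in
/-- The characteristic function of an open-closed subset. -/
def charFun (A : Clopens X) : LocallyConstant X k := LocallyConstant.charFn k A.isClopen

theorem charFun_apply_of_mem {A : Clopens X} {x : X} (h : x ∈ A) : charFun k A x = 1 :=
  Set.indicator_of_mem (s := (A : Set X)) h 1

theorem charFun_apply_of_notMem {A : Clopens X} {x : X} (h : x ∉ A) : charFun k A x = 0 :=
  Set.indicator_of_notMem (s := (A : Set X)) h 1

theorem charFun_sup {A B : Clopens X} (h : Disjoint A B) :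
    charFun k (A ⊔ B) = charFun k A + charFun k B := by
  ext x
  exact congrFun (Set.indicator_union_of_disjoint (Clopens.coe_disjoint.2 h) (1 : X → k)) x

/-- The integral of scalar locally constant functions with respect to a measure. -/
def scalarIntegral (μ : csMeasure k X V) : LocallyConstant X k →ₗ[k] V where
  toFun f := TensorProduct.lid k V (integral k f μ)
  map_add' f g := by rw [integral_add_left, map_add]
  map_smul' c f := by rw [integral_smul_left, map_smul]; rfl

/-- A measure is concentrated on a set if it vanishes on open-closed subsets disjoint from it. -/
def IsConcentrated (μ : csMeasure k X V) (K : Set X) : Prop :=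
  ∀ B : Clopens X, Disjoint (B : Set X) K → μ.1 B = 0

theorem IsConcentrated.apply_eq_top {μ : csMeasure k X V} {K : Set X} (hμ : IsConcentrated μ K)
    {A : Clopens X} (hA : K ⊆ A) : μ.1 A = μ.1 ⊤ := by
  have h := csMeasure_add μ A Aᶜ disjoint_compl_right
  rw [sup_compl_eq_top, hμ Aᶜ, add_zero] at h
  · exact h.symm
  · exact Set.disjoint_left.2 fun x hx hxK => hx (hA hxK)

theorem IsConcentrated.apply_inf {μ : csMeasure k X V} {U : Clopens X}
    (hμ : IsConcentrated μ U) (A : Clopens X) : μ.1 (A ⊓ U) = μ.1 A := by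
  have h := csMeasure_add μ (A ⊓ U) (A \ U) disjoint_inf_sdiff
  rw [sup_inf_sdiff, hμ (A \ U), add_zero] at h
  · exact h.symm
  · exact Set.disjoint_left.2 fun x hx hxK => hx.2 hxK

theorem IsConcentrated.integral_eq {μ : csMeasure k X V} {K : Set X} (hμ : IsConcentrated μ K)
    {N : Type*} [AddCommGroup N] [Module k N] {f : LocallyConstant X N} {v : N}
    (hf : ∀ x ∈ K, f x = v) : integral k f μ = v ⊗ₜ[k] μ.1 ⊤ := by
  rw [integral_eq_sum f μ hμ {v} fun x hx => Finset.mem_singleton.2 (hf x hx),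
    Finset.sum_singleton, hμ.apply_eq_top fun x hx => hf x hx]

theorem scalarIntegral_charFun (μ : csMeasure k X V) (A : Clopens X) :
    scalarIntegral μ (charFun k A) = μ.1 A := by
  classical
  change TensorProduct.lid k V (integral k (charFun k A) μ) = _
  -- `integral_eq_sum` asks only for finitely many values on `K`, not for compactness, so the whole
  -- space serves.
  rw [integral_eq_sum (charFun k A) μ (K := Set.univ) (fun B hB => ?_) {0, 1} fun x _ => ?_,
    Finset.sum_pair zero_ne_one, TensorProduct.zero_tmul, zero_add, TensorProduct.lid_tmul,
    one_smul]
  · refine congrArg μ.1 (Clopens.ext (Set.ext fun x => ?_))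
    change charFun k A x = 1 ↔ x ∈ A
    exact LocallyConstant.charFn_eq_one k x A.isClopen
  · rw [show B = ⊥ from Clopens.ext (by simpa using hB), csMeasure_bot]
  · by_cases h : x ∈ A
    · simp [charFun_apply_of_mem h]
    · simp [charFun_apply_of_notMem h]

/-- The measure concentrated on a compact open-closed subset `U` given by a linear functional on
locally constant functions. -/
def measureOfFunctional (U : Clopens X) (hU : IsCompact (U : Set X))
    (M : LocallyConstant X k →ₗ[k] V) : csMeasure k X V :=
  ⟨fun A => M (charFun k (A ⊓ U)), by
    refine ⟨fun A B h => ?_, U, hU, fun A h => ?_⟩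
    · beta_reduce
      rw [inf_sup_right, charFun_sup (h.mono inf_le_left inf_le_left), map_add]
    · have h0 : charFun k (A ⊓ U) = 0 := by
        ext x
        exact charFun_apply_of_notMem fun hx => Set.disjoint_left.1 h hx.1 hx.2
      beta_reduce
      rw [h0, map_zero]⟩

/-- The restriction of a measure to an open-closed subset. -/
def restrictMeasure (μ : csMeasure k X V) (U : Clopens X) : csMeasure k X V :=
  ⟨fun A => μ.1 (A ⊓ U), by
    obtain ⟨K, hK, hμK⟩ := μ.2.2
    refine ⟨fun A B h => ?_, K, hK, fun A h => hμK _ (h.mono_left Set.inter_subset_left)⟩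
    beta_reduce
    rw [inf_sup_right, csMeasure_add μ _ _ (h.mono inf_le_left inf_le_left)]⟩

theorem isConcentrated_restrictMeasure (μ : csMeasure k X V) (U : Clopens X) :
    IsConcentrated (restrictMeasure μ U) U := by
  intro B hB
  change μ.1 (B ⊓ U) = 0
  rw [(Clopens.coe_disjoint.1 hB).eq_bot, csMeasure_bot]

/-- Every measure is a finite sum of its restrictions to the fibres of a locally constant
function. -/
theorem exists_eq_sum_restrictMeasure {A : Type*} (f : LocallyConstant X A)
    (μ : csMeasure k X V) :
    ∃ s : Finset A, μ = ∑ a ∈ s, restrictMeasure μ (fiber f a) := by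
  obtain ⟨K, hK, hμK⟩ := μ.2.2
  obtain ⟨s, hs⟩ := exists_fiber_finset f hK
  refine ⟨s, Subtype.ext (funext fun U => ?_)⟩
  rw [csMeasure_eq_sum_fibers f μ hμK s U fun x hx _ => hs x hx]
  simp only [AddSubmonoidClass.coe_finsetSum, Finset.sum_apply]
  rfl

end Functionals

/-- `Λ` descends to the range of `D`, and over a field a linear map extends from a subspace. -/
theorem _root_.LinearMap.exists_comp_eq_of_ker_le {k : Type*} [Field k] {E F V : Type*}
    [AddCommGroup E] [Module k E] [AddCommGroup F] [Module k F] [AddCommGroup V] [Module k V]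
    (D : E →ₗ[k] F) (Λ : E →ₗ[k] V) (h : LinearMap.ker D ≤ LinearMap.ker Λ) :
    ∃ M : F →ₗ[k] V, M ∘ₗ D = Λ := by
  obtain ⟨M, hM⟩ := LinearMap.exists_extend
    ((LinearMap.ker D).liftQ Λ h ∘ₗ D.quotKerEquivRange.symm.toLinearMap)
  refine ⟨M, LinearMap.ext fun x => ?_⟩
  have hx := LinearMap.congr_fun hM (D.quotKerEquivRange (Submodule.Quotient.mk x))
  simpa using hx

/-! ### Contraaction of measures concentrated on a compact open subgroup -/

section Contraaction

variable {k : Type*} [Field k] {G : Type*} [Group G] [TopologicalSpace G]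
variable {V : Type*} [AddCommGroup V] [Module k V]
variable {P : Type*} [AddCommGroup P] [Module k P]

/-- Left multiplication as a continuous map. -/
def leftMul [ContinuousMul G] (g : G) : C(G, G) := ⟨fun x => g * x, continuous_const_mul g⟩

/-- Right multiplication as a continuous map. -/
def rightMul [ContinuousMul G] (g : G) : C(G, G) := ⟨fun x => x * g, continuous_mul_const g⟩

/-- Contraassociativity for `μ` placed on the slice `G × {g}`: currying yields the point measure at
`g` with value `μ`. -/
theorem Contramodule.contraaction_pushforward_rightMul [ContinuousMul G]
    (π : Contramodule k G P) (g : G) (μ : csMeasure k G P) :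
    π.contraaction (pushforward (rightMul g) μ) = π.rep g⁻¹ (π.contraaction μ) := by
  classical
  have e := π.contraassociative (pushforward ⟨fun x => (x, g), by fun_prop⟩ μ)
  have e2 : mapValues π.contraaction
      (curryMeasure (pushforward ⟨fun x => (x, g), by fun_prop⟩ μ)) =
      pointMeasure g (π.contraaction μ) := by
    refine Subtype.ext (funext fun B => ?_)
    rw [pointMeasure_apply]
    have e3 : (curryMeasure (pushforward ⟨fun x => (x, g), by fun_prop⟩ μ)).1 B =
        if g ∈ B then μ else 0 := by
      refine Subtype.ext (funext fun A => ?_)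
      change μ.1 (clopenPreimage _ (A ×ˢ B)) = _
      split_ifs with h
      · refine congrArg μ.1 (Clopens.ext (Set.ext fun x => ?_))
        exact ⟨fun hx => hx.1, fun hx => ⟨hx, h⟩⟩
      · rw [show clopenPreimage _ (A ×ˢ B) = ⊥ from
          Clopens.ext (Set.eq_empty_of_forall_notMem fun x hx => h hx.2), csMeasure_bot]
        rfl
    change π.contraaction ((curryMeasure (pushforward _ μ)).1 B) = _
    rw [e3]
    split_ifs <;> simp
  rw [e2] at e
  change _ = π.contraaction (pointMeasure g⁻¹⁻¹ (π.contraaction μ))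
  rw [inv_inv]
  exact e

/-- The same on the slice `{g} × G`. Here the inner measures are point measures at `g`, so `g⁻¹`
acts on the values of `μ`. -/
theorem Contramodule.contraaction_pushforward_leftMul [ContinuousMul G]
    (π : Contramodule k G P) (g : G) (μ : csMeasure k G P) :
    π.contraaction (pushforward (leftMul g) μ) =
      π.contraaction (mapValues (π.rep g⁻¹) μ) := by
  classical
  have e := π.contraassociative (pushforward ⟨fun x => (g, x), by fun_prop⟩ μ)
  have e2 : mapValues π.contraaction
      (curryMeasure (pushforward ⟨fun x => (g, x), by fun_prop⟩ μ)) =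
      mapValues (π.rep g⁻¹) μ := by
    refine Subtype.ext (funext fun B => ?_)
    change _ = π.contraaction (pointMeasure g⁻¹⁻¹ (μ.1 B))
    refine congrArg π.contraaction (Subtype.ext (funext fun A => ?_))
    rw [inv_inv, pointMeasure_apply]
    change μ.1 (clopenPreimage _ (A ×ˢ B)) = _
    split_ifs with h
    · refine congrArg μ.1 (Clopens.ext (Set.ext fun x => ?_))
      exact ⟨fun hx => hx.2, fun hx => ⟨h, hx⟩⟩
    · rw [show clopenPreimage _ (A ×ˢ B) = ⊥ from
        Clopens.ext (Set.eq_empty_of_forall_notMem fun x hx => h hx.1), csMeasure_bot]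
  rw [e2] at e
  exact e

/-- The differences of right translations by the elements of `T` with the identity, on locally
constant functions. -/
def translationDifference (k : Type*) [Field k] [ContinuousMul G] (T : Finset G) :
    LocallyConstant G k →ₗ[k] T → LocallyConstant G k :=
  LinearMap.pi fun t => LocallyConstant.comapₗ k (rightMul t.1) - LinearMap.id

/-- The right periods of `f` form a subgroup containing `T`, and the fibre of `f` through `1` is
closed. This identifies what a functional must kill in order to factor through the differences along
`T`. -/
theorem eq_apply_one_of_translationDifference_eq_zero [IsTopologicalGroup G] {T : Finset G}
    {f : LocallyConstant G k} (hf : translationDifference k T f = 0) {u : G}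
    (hu : u ∈ closure (Subgroup.closure (T : Set G) : Set G)) : f u = f 1 := by
  have hT : ∀ t ∈ T, ∀ x, f (x * t) = f x := fun t ht x =>
    sub_eq_zero.1 (LocallyConstant.congr_fun (congrFun hf ⟨t, ht⟩) x)
  let K : Subgroup G :=
    { carrier := {g | ∀ x, f (x * g) = f x}
      one_mem' := fun x => by rw [mul_one]
      mul_mem' := fun {a b} ha hb x => by rw [← mul_assoc, hb, ha]
      inv_mem' := fun {a} ha x => by rw [← ha (x * a⁻¹), inv_mul_cancel_right] }
  have hK : Subgroup.closure (T : Set G) ≤ K := (Subgroup.closure_le K).2 hT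
  have hclosed : IsClosed (f ⁻¹' {f 1}) := f.isLocallyConstant.isClosed_fiber _
  refine closure_minimal (fun g hg => ?_) hclosed hu
  have h := hK hg 1
  rwa [one_mul] at h

/-- A measure concentrated on a compact open subgroup differs from the point measure at `1` with
the same total mass by a finite sum of differences of translates along topological generators. -/
theorem exists_eq_sum_translates [IsTopologicalGroup G] (U : Subgroup G)
    (hUo : IsOpen (U : Set G)) (hUc : IsCompact (U : Set G)) (T : Finset G)
    (hTU : (T : Set G) ⊆ U) (hT : (U : Set G) ⊆ closure (Subgroup.closure (T : Set G) : Set G))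
    (ν : csMeasure k G V) (hν : IsConcentrated ν U) :
    ∃ μ : T → csMeasure k G V,
      ν = pointMeasure 1 (ν.1 ⊤) + ∑ t, (pushforward (rightMul t.1) (μ t) - μ t) := by
  classical
  let C : Clopens G := ⟨U, U.isClosed_of_isOpen hUo, hUo⟩
  -- The functional of `ν - δ₁ ν(⊤)`. It vanishes on functions constant on `U`, in particular on the
  -- kernel of `D`, so it factors as `M ∘ D`.
  let Λ : LocallyConstant G k →ₗ[k] V := scalarIntegral ν -
    { toFun := fun f => f 1 • ν.1 ⊤
      map_add' := fun f g => add_smul _ _ _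
      map_smul' := fun c f => mul_smul _ _ _ }
  have hΛ (f : LocallyConstant G k) : Λ f = scalarIntegral ν f - f 1 • ν.1 ⊤ := rfl
  let D := translationDifference k T
  obtain ⟨M, hM⟩ := LinearMap.exists_comp_eq_of_ker_le D Λ (by
    intro f hf
    have hf' : ∀ u ∈ (U : Set G), f u = f 1 := fun u hu =>
      eq_apply_one_of_translationDifference_eq_zero hf (hT hu)
    rw [LinearMap.mem_ker, hΛ]
    change TensorProduct.lid k V (integral k f ν) - _ = 0
    rw [hν.integral_eq hf', TensorProduct.lid_tmul, sub_self])
  -- The components of `M` become the measures `μ t`. Finiteness of `T` lets `M` be recovered as the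
  -- sum of its components.
  refine ⟨fun t => measureOfFunctional C hUc (M ∘ₗ LinearMap.single k (fun _ => LocallyConstant G k) t), ?_⟩
  refine Subtype.ext (funext fun A => ?_)
  have h1 : Λ (charFun k (A ⊓ C)) = ν.1 A - (pointMeasure (k := k) (1 : G) (ν.1 ⊤)).1 A := by
    rw [hΛ, scalarIntegral_charFun, IsConcentrated.apply_inf (U := C) hν, pointMeasure_apply]
    congr 1
    by_cases h : (1 : G) ∈ A
    · rw [charFun_apply_of_mem (show (1 : G) ∈ A ⊓ C from ⟨h, U.one_mem⟩), one_smul, if_pos h]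
    · rw [charFun_apply_of_notMem fun h' : (1 : G) ∈ A ⊓ C => h h'.1, zero_smul, if_neg h]
  have h2 : Λ (charFun k (A ⊓ C)) =
      ∑ t : T, (M (Pi.single t (charFun k (clopenPreimage (rightMul t.1) A ⊓ C))) -
        M (Pi.single t (charFun k (A ⊓ C)))) := by
    rw [← hM, LinearMap.comp_apply, ← Finset.univ_sum_single (D _), map_sum]
    refine Finset.sum_congr rfl fun t _ => ?_
    rw [← map_sub, ← Pi.single_sub]
    congr 2
    change LocallyConstant.comap (rightMul t.1) (charFun k (A ⊓ C)) - charFun k (A ⊓ C) = _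
    congr 1
    ext x
    change charFun k (A ⊓ C) (x * t) = _
    -- Right translation by `t` preserves `U`, so it commutes with cutting down to `C`.
    have ht : (t : G) ∈ U := hTU t.2
    by_cases h : x * t ∈ A ⊓ C
    · rw [charFun_apply_of_mem h, charFun_apply_of_mem]
      exact ⟨h.1, (U.mul_mem_cancel_right ht).1 h.2⟩
    · rw [charFun_apply_of_notMem h, charFun_apply_of_notMem]
      exact fun h' => h ⟨h'.1, (U.mul_mem_cancel_right ht).2 h'.2⟩
  rw [h1, sub_eq_iff_eq_add'] at h2
  rw [h2]
  rw [Submodule.coe_add, AddSubmonoidClass.coe_finsetSum, Pi.add_apply, Finset.sum_apply]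
  rfl

theorem Contramodule.contraaction_sub_mem_span [IsTopologicalGroup G] (π : Contramodule k G P)
    (U : Subgroup G) (hUo : IsOpen (U : Set G)) (hUc : IsCompact (U : Set G)) (T : Finset G)
    (hTU : (T : Set G) ⊆ U) (hT : (U : Set G) ⊆ closure (Subgroup.closure (T : Set G) : Set G))
    (ν : csMeasure k G P) (hν : IsConcentrated ν U) :
    π.contraaction ν - ν.1 ⊤ ∈
      Submodule.span k {z | ∃ t ∈ T, ∃ y, z = π.rep t⁻¹ y - y} := by
  obtain ⟨μ, hμ⟩ := exists_eq_sum_translates U hUo hUc T hTU hT ν hν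
  have h : π.contraaction ν - ν.1 ⊤ =
      ∑ t : T, (π.rep (t : G)⁻¹ (π.contraaction (μ t)) - π.contraaction (μ t)) := by
    nth_rw 1 [hμ]
    simp only [map_add, map_sum, map_sub, π.contraunital, add_sub_cancel_left,
      π.contraaction_pushforward_rightMul]
  rw [h]
  exact Submodule.sum_mem _ fun t _ => Submodule.subset_span ⟨t, t.2, _, rfl⟩

end Contraaction

/-! ### Comparison of the tensor product with the contratensor product -/

section Comparison

variable {k : Type*} [Field k] {G : Type*} [Group G] [TopologicalSpace G]
variable {N : Type*} [AddCommGroup N] [Module k N]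
variable {P : Type*} [AddCommGroup P] [Module k P]

theorem tmul_sub_mem_balancedRelations {Γ : Type*} [Group Γ] (ρ : Representation k Γ N)
    (σ : Representation k Γ P) (g : Γ) (x : N) (y : P) :
    x ⊗ₜ[k] σ g⁻¹ y - ρ g x ⊗ₜ[k] y ∈ balancedRelations ρ σ := by
  rw [← neg_mem_iff, neg_sub]
  refine Submodule.subset_span ⟨x, MonoidAlgebra.single g⁻¹ 1, y, ?_⟩
  simp [rightAction, MonoidAlgebra.lift_single]

/-- Moving `t` across the tensor sign gives `x ⊗ t⁻¹y ≡ tx ⊗ y = x ⊗ y`. The homomorphism `i` covers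
both `G` itself and a subgroup. -/
theorem tmul_mem_balancedRelations {G Γ : Type*} [Group G] [Group Γ] (i : Γ →* G)
    (ρ : Representation k G N) (σ : Representation k G P) {x : N} {T : Set G}
    (hTi : T ⊆ i.range) (hTx : ∀ t ∈ T, ρ t x = x) {z : P}
    (hz : z ∈ Submodule.span k {z | ∃ t ∈ T, ∃ y, z = σ t⁻¹ y - y}) :
    x ⊗ₜ[k] z ∈ balancedRelations (ρ.comp i) (σ.comp i) := by
  have hle : Submodule.span k {z | ∃ t ∈ T, ∃ y, z = σ t⁻¹ y - y} ≤
      (balancedRelations (ρ.comp i) (σ.comp i)).comap (TensorProduct.mk k N P x) := by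
    rw [Submodule.span_le]
    rintro _ ⟨t, ht, y, rfl⟩
    obtain ⟨γ, rfl⟩ := hTi ht
    have h := tmul_sub_mem_balancedRelations (ρ.comp i) (σ.comp i) γ x y
    simp only [MonoidHom.comp_apply, hTx _ ht, ← TensorProduct.tmul_sub, map_inv i] at h
    exact h
  exact hle hz

/-- The relation in the contratensor product given by a measure concentrated on a coset of an open
subgroup stabilizing the given vector. -/
theorem tmul_contraaction_sub_mem [IsTopologicalGroup G] {Γ : Type*} [Group Γ] (i : Γ →* G)
    (ρ : Representation k G N) (π : Contramodule k G P) (x : N) (U : Subgroup G)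
    (hUo : IsOpen (U : Set G)) (hUc : IsCompact (U : Set G)) (hUx : ∀ u ∈ U, ρ u x = x)
    (T : Finset G) (hTi : (T : Set G) ⊆ i.range) (hTU : (T : Set G) ⊆ U)
    (hT : (U : Set G) ⊆ closure (Subgroup.closure (T : Set G) : Set G))
    (γ : Γ) (μ : csMeasure k G P) (hμ : IsConcentrated μ ((fun u => i γ * u) '' U)) :
    x ⊗ₜ[k] π.contraaction μ - ρ (i γ) x ⊗ₜ[k] μ.1 ⊤ ∈
      balancedRelations (ρ.comp i) (π.rep.comp i) := by
  have hν : pushforward (leftMul (i γ)) (pushforward (leftMul (i γ)⁻¹) μ) = μ := by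
    refine Subtype.ext (funext fun A => congrArg μ.1 (Clopens.ext (Set.ext fun y => ?_)))
    change i γ * ((i γ)⁻¹ * y) ∈ A ↔ y ∈ A
    rw [mul_inv_cancel_left]
  -- Translating `μ` back from `γU` to `U` costs an action of `γ⁻¹` on its values.
  let ν := mapValues (π.rep (i γ)⁻¹) (pushforward (leftMul (i γ)⁻¹) μ)
  have hπ : π.contraaction μ = π.contraaction ν := by
    rw [← π.contraaction_pushforward_leftMul, hν]
  have hνtop : ν.1 ⊤ = π.rep (i γ)⁻¹ (μ.1 ⊤) := rfl
  have hνU : IsConcentrated ν U := by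
    intro B hB
    change π.rep (i γ)⁻¹ (μ.1 (clopenPreimage (leftMul (i γ)⁻¹) B)) = 0
    rw [hμ, map_zero]
    rw [Set.disjoint_left]
    rintro _ h ⟨u, hu, rfl⟩
    have h' : (i γ)⁻¹ * (i γ * u) ∈ B := h
    rw [inv_mul_cancel_left] at h'
    exact Set.disjoint_left.1 hB h' hu
  have h1 := tmul_mem_balancedRelations i ρ π.rep hTi (fun t ht => hUx t (hTU ht))
    (π.contraaction_sub_mem_span U hUo hUc T hTU hT ν hνU)
  -- This relation moves that `γ⁻¹` onto `x`, where it becomes `γx`.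
  have h2 := tmul_sub_mem_balancedRelations (ρ.comp i) (π.rep.comp i) γ x (μ.1 ⊤)
  have h3 := add_mem h1 h2
  simp only [MonoidHom.comp_apply, map_inv i] at h3
  rwa [hνtop, TensorProduct.tmul_sub, sub_add_sub_cancel, ← hπ] at h3

/-- The quotient map to the left cosets of an open subgroup. -/
def cosetMap [ContinuousMul G] (U : Subgroup G) (hU : IsOpen (U : Set G)) :
    LocallyConstant G (G ⧸ U) where
  toFun := QuotientGroup.mk
  isLocallyConstant := by
    rw [IsLocallyConstant.iff_exists_open]
    intro g
    refine ⟨(fun h => g⁻¹ * h) ⁻¹' U, hU.preimage (continuous_const_mul _), by simp,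
      fun h hh => (QuotientGroup.eq.2 hh).symm⟩

/-- The converse of `balancedRelations_le`, and the main content of the theorem. -/
theorem range_le_balancedRelations [IsTopologicalGroup G] {Γ : Type*} [Group Γ] (i : Γ →* G)
    (hi : DenseRange i) (ρ : Representation k G N) (hρ : IsSmooth ρ) (π : Contramodule k G P)
    (H : Subgroup G) (hHo : IsOpen (H : Set G)) (hHc : IsCompact (H : Set G))
    (S : Finset G) (hSi : (S : Set G) ⊆ i.range) (hSH : (S : Set G) ⊆ H)
    (hS : (H : Set G) ⊆ closure (Subgroup.closure (S : Set G) : Set G)) :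
    LinearMap.range (contraMap N π - integralMap ρ hρ P) ≤
      balancedRelations (ρ.comp i) (π.rep.comp i) := by
  rintro _ ⟨w, rfl⟩
  induction w using TensorProduct.induction_on with
  | zero => rw [map_zero]; exact zero_mem _
  | add a b ha hb => rw [map_add]; exact add_mem ha hb
  | tmul x μ =>
    -- On each left coset of this open compact subgroup the orbit map of `x` is constant.
    let U : Subgroup G :=
      { carrier := {g | g ∈ H ∧ ρ g x = x}
        one_mem' := ⟨H.one_mem, by simp⟩
        mul_mem' := fun {a b} ha hb => ⟨H.mul_mem ha.1 hb.1, by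
          rw [map_mul, Module.End.mul_apply, hb.2, ha.2]⟩
        inv_mem' := fun {a} ha => ⟨H.inv_mem ha.1, by
          nth_rw 1 [← ha.2]
          rw [← Module.End.mul_apply, ← map_mul, inv_mul_cancel, map_one,
            Module.End.one_apply]⟩ }
    have hUH : U ≤ H := fun _ hu => hu.1
    have hUo : IsOpen (U : Set G) := hHo.inter (hρ x)
    have hUc : IsCompact (U : Set G) := hHc.of_isClosed_subset (U.isClosed_of_isOpen hUo) hUH
    obtain ⟨T, hTS, hTU, hT⟩ := exists_finset_generators_of_open hHc S hSH hS U hUo hUH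
    have hTi : (T : Set G) ⊆ i.range := fun t ht => (Subgroup.closure_le _).2 hSi (hTS ht)
    obtain ⟨s, hs⟩ := exists_eq_sum_restrictMeasure (cosetMap U hUo) μ
    rw [hs, TensorProduct.tmul_sum, map_sum]
    refine Submodule.sum_mem _ fun c _ => ?_
    -- Only elements of `Γ` may cross the tensor sign, so density is used to represent the open
    -- coset from `Γ`.
    obtain ⟨γ, hg⟩ := hi.exists_mem_open
      ((cosetMap U hUo).isLocallyConstant.isOpen_fiber c) (QuotientGroup.mk_surjective c)
    have hfib : (fiber (cosetMap U hUo) c : Set G) = (fun u => i γ * u) '' U := by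
      ext y
      have hc : QuotientGroup.mk (i γ) = c := hg
      change QuotientGroup.mk y = c ↔ _
      rw [← hc, eq_comm, QuotientGroup.eq]
      exact ⟨fun h => ⟨_, h, mul_inv_cancel_left _ _⟩, by
        rintro ⟨u, hu, rfl⟩
        simpa using hu⟩
    have hconc := hfib ▸ isConcentrated_restrictMeasure μ (fiber (cosetMap U hUo) c)
    have hmem := tmul_contraaction_sub_mem i ρ π x U hUo hUc (fun u hu => hu.2) T hTi hTU hT γ
      _ hconc
    have horb : ∀ y ∈ (fun u => i γ * u) '' (U : Set G), orbitMap ρ hρ x y = ρ (i γ) x := by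
      rintro _ ⟨u, hu, rfl⟩
      change ρ (i γ * u) x = _
      rw [map_mul, Module.End.mul_apply, hu.2]
    rw [← hconc.integral_eq horb] at hmem
    exact hmem

theorem bijective_factor_of_le {R M : Type*} [Ring R] [AddCommGroup M] [Module R M]
    {A B : Submodule R M} (h : A ≤ B) (h' : B ≤ A) :
    Function.Bijective (Submodule.factor h) := by
  obtain rfl := le_antisymm h h'
  refine ⟨?_, Submodule.factor_surjective h⟩
  rw [show Submodule.factor h = LinearMap.id from Submodule.mapQ_id A h]
  exact Function.injective_id

end Comparison

end LocProfinite

end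

theorem mainTheorem4
    (p : ℕ) [Fact p.Prime] (k : Type*) [Field k] [CharP k p]
    (G : Type*) [Group G] [TopologicalSpace G] [IsTopologicalGroup G]
    [LocallyCompactSpace G] [T2Space G] [TotallyDisconnectedSpace G]
    (H : Subgroup G) (hHopen : IsOpen (H : Set G)) (hHcompact : IsCompact (H : Set G))
    (hHprop : LocProfinite.IsProP p H) (hHfg : LocProfinite.IsTopologicallyFG H)
    (N : Type*) [AddCommGroup N] [Module k N]
    (ρ : Representation k G N) (hρ : LocProfinite.IsSmooth ρ)
    (P : Type*) [AddCommGroup P] [Module k P] (π : LocProfinite.Contramodule k G P) :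
    Function.Bijective (LocProfinite.toContratensor ρ hρ π) ∧
    ∀ G' : Subgroup G, Dense (G' : Set G) →
      Function.Bijective (LocProfinite.subgroupToContratensor G' ρ hρ π) := by
  -- Since `H` is open, `G' ∩ H` is dense in `H`, and the pro-`p` generation result applies inside
  -- `H`.
  have key : ∀ G' : Subgroup G, Dense (G' : Set G) → ∃ S : Finset G, (S : Set G) ⊆ G' ∧
      (S : Set G) ⊆ H ∧ (H : Set G) ⊆ closure (Subgroup.closure (S : Set G) : Set G) := by
    classical
    intro G' hG'
    obtain ⟨S, hSD, hS⟩ := hHprop.exists_finset_generators hHfg (G'.subgroupOf H)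
      (hG'.preimage hHopen.isOpenMap_subtype_val)
    refine ⟨S.image H.subtype, ?_, ?_, fun h hh => ?_⟩
    · intro _ hx
      obtain ⟨s, hs, rfl⟩ := Finset.mem_image.1 (Finset.mem_coe.1 hx)
      exact hSD hs
    · intro _ hx
      obtain ⟨s, hs, rfl⟩ := Finset.mem_image.1 (Finset.mem_coe.1 hx)
      exact s.2
    · rw [Finset.coe_image, ← MonoidHom.map_closure]
      exact image_closure_subset_closure_image continuous_subtype_val
        ⟨⟨h, hh⟩, hS _, rfl⟩
  constructor
  -- The case of `G` itself is that of the identity homomorphism, with generators taken anywhere in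
  -- `H`.
  · obtain ⟨S, -, hSH, hS⟩ := key ⊤ (by simp)
    exact LocProfinite.bijective_factor_of_le
      (LocProfinite.balancedRelations_le (MonoidHom.id G) ρ hρ π)
      (LocProfinite.range_le_balancedRelations (MonoidHom.id G) Function.surjective_id.denseRange
        ρ hρ π H hHopen hHcompact S (fun x _ => ⟨x, rfl⟩) hSH hS)
  · intro G' hG'
    obtain ⟨S, hSG, hSH, hS⟩ := key G' hG'
    exact LocProfinite.bijective_factor_of_le
      (LocProfinite.balancedRelations_le G'.subtype ρ hρ π)
      (LocProfinite.range_le_balancedRelations G'.subtype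
        (by simpa [DenseRange] using hG') ρ hρ π H hHopen hHcompact S
        (by simpa using hSG) hSH hS)
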